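/- Let $k$ be a field, let $p\ge 1$ and $n\ge 0$ be integers, and let $e_1,\dots,e_N$ denote the standard basis of $k^N$. An element of $\bigwedge^p k^N$ is called decomposable if it is of the form $v_1\wedge\cdots\wedge v_p$ with $v_i\in k^N$ (so $0$ is decomposable), and indecomposable otherwise. A linear map $\bigwedge^p k^n\to\bigwedge^{p'}k^{n'}$ is called Grassmann cone preserving if it sends decomposable elements to decomposable elements. Consider triples $(\mathcal A,\mathcal B,\mathcal C)$, where, for some integer $m$ with $0\le m\le p-2$, $\mathcal A=\{\alpha_1,\dots,\alpha_4\}$, $\mathcal B=\{(\beta_1^{0},\beta_1^{1}),\dots,(\beta_m^{0},\beta_m^{1})\}$ and $\mathcal C=\{\gamma_1,\dots,\gamma_{p-m-2}\}$, such that the indices $\alpha_i,\beta_j^{\nu},\gamma_l\in\{1,\dots,n\}$ are all distinct and $$\alpha_i<\alpha_{i+1},\quad \beta_i^0<\beta_i^1,\quad \beta_i^\nu<\beta_{i+1}^\nu,\quad \beta_i^0<\alpha_1,\quad \beta_i^1<\alpha_3,\quad \gamma_i<\gamma_{i+1}$$ whenever these make sense. For such a triple write $\mathcal A\cup\{\beta_1^1,\dots,\beta_m^1\}\cup\mathcal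 C=\{\xi_1<\cdots<\xi_{p+2}\}$ and define linear maps as follows. * $X=X_{\mathcal A,\mathcal B,\mathcal C}\colon k^n\to k^{p+2}$ is given by $X(e_i)=e_j$ if $i=\xi_j$, or if $i=\beta_l^0$ and $\xi_j=\beta_l^1$ for some $l$; and $X(e_i)=0$ if there is no such $j$. * $\delta\colon\bigwedge^p k^{p+2}\to\bigwedge^2 k^{p+2}$ is given by $\delta(e_{i_1}\wedge\cdots\wedge e_{i_p})=e_{j_1}\wedge e_{j_2}$ for $i_1<\cdots<i_p$, where $j_1<j_2$ and $\{i_1,\dots,i_p\}\cup\{j_1,j_2\}=\{1,\dots,p+2\}$. * $Z\colon k^{p+2}\to k^4$ is given by $Z(e_i)=e_j$ if $e_i=X(e_{\alpha_j})$; and $Z(e_i)=0$ if there is no such $j$. * $G_{\mathcal A,\mathcal B,\mathcal C}=\bigwedge^2Z\circ\delta\circ\bigwedge^pX_{\mathcal A,\mathcal B,\mathcal C}\colon\bigwedge^p k^n\to\bigwedge^2k^4$. Then every $G_{\mathcal A,\mathcal B,\mathcal C}$ is Grassmann cone preserving, and an element $\omega\in\bigwedge^p k^n$ is indecomposable if and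 only if there is a triple $(\mathcal A,\mathcal B,\mathcal C)$ as above such that $G_{\mathcal A,\mathcal B,\mathcal C}(\omega)\in\bigwedge^2k^4$ is indecomposable. -/

import Mathlib

namespace GrassmannCone

/-- An element of the `p`-th exterior power `⋀^p M` is decomposable if it is of the form
`v₁ ∧ ⋯ ∧ v_p`. -/
def IsDecomposable {k M : Type*} [Field k] [AddCommGroup M] [Module k M] {p : ℕ}
    (ω : ⋀[k]^p M) : Prop :=
  ∃ v : Fin p → M, ω = exteriorPower.ιMulti k p v

/-- The Grassmann cone `Γ^p M`: the set of decomposable elements of `⋀^p M`. -/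
def cone (k M : Type*) [Field k] [AddCommGroup M] [Module k M] (p : ℕ) : Set (⋀[k]^p M) :=
  {ω | IsDecomposable ω}

/-- A linear map between exterior powers is Grassmann cone preserving (GCP) if it maps
decomposable elements to decomposable elements. -/
def IsGCP {k M M' : Type*} [Field k] [AddCommGroup M] [Module k M] [AddCommGroup M']
    [Module k M'] {p p' : ℕ} (F : (⋀[k]^p M) →ₗ[k] (⋀[k]^p' M')) : Prop :=
  F '' cone k M p ⊆ cone k M' p'

/-- The basis `e_{i₁} ∧ ⋯ ∧ e_{i_p}`, `i₁ < ⋯ < i_p`, of `⋀^p k^N`, indexed by the `p`-element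
subsets `{i₁, …, i_p}` of `Fin N`. -/
noncomputable def wedgeBasis (k : Type*) [Field k] (N p : ℕ) :
    Module.Basis (Set.powersetCard (Fin N) p) k (⋀[k]^p (Fin N → k)) :=
  (Pi.basisFun k (Fin N)).exteriorPower p

/-- The dual isomorphism `δ : ⋀^p k^N → ⋀^q k^N`, `p + q = N`, which sends
`e_{i₁} ∧ ⋯ ∧ e_{i_p}` to `e_{j₁} ∧ ⋯ ∧ e_{j_q}` (without a sign), where `i₁ < ⋯ < i_p`,
`j₁ < ⋯ < j_q` and `{j₁, …, j_q}` is the complement of `{i₁, …, i_p}`. -/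
noncomputable def dualIso (k : Type*) [Field k] {N p q : ℕ} (h : p + q = N) :
    (⋀[k]^p (Fin N → k)) ≃ₗ[k] (⋀[k]^q (Fin N → k)) :=
  (wedgeBasis k N p).equiv (wedgeBasis k N q)
    (Set.powersetCard.compl (by rw [Fintype.card_fin, ← h, Nat.add_comm]))

/-- A triple `𝒜 = {α₁, …, α₄}`, `ℬ = {(β₁⁰, β₁¹), …, (β_m⁰, β_m¹)}`,
`𝒞 = {γ₁, …, γ_{p-m-2}}` of indices in `{1, …, n}`, all distinct and such that `α_i < α_{i+1}`,
`β_i⁰ < β_i¹`, `β_i^ν < β_{i+1}^ν`, `β_i⁰ < α₁`, `β_i¹ < α₃`, `γ_i < γ_{i+1}`.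
All indices are counted from `0` here. -/
structure IndexTriple (p n : ℕ) where
  m : ℕ
  m_le : m + 2 ≤ p
  α : Fin 4 → Fin n
  β : Fin 2 → Fin m → Fin n
  γ : Fin (p - m - 2) → Fin n
  distinct : Function.Injective
    (Sum.elim α (Sum.elim (fun x : Fin 2 × Fin m => β x.1 x.2) γ))
  α_lt : StrictMono α
  β_pair_lt : ∀ i, β 0 i < β 1 i
  β_lt : ∀ ν, StrictMono (β ν)
  β_zero_lt : ∀ i, β 0 i < α 0
  β_one_lt : ∀ i, β 1 i < α 2
  γ_lt : StrictMono γ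

namespace IndexTriple

variable {p n : ℕ} (T : IndexTriple p n)

/-- The set `S' = 𝒜 ∪ B₁ ∪ 𝒞`, where `B₁ = {β₁¹, …, β_m¹}`. -/
def S' : Finset (Fin n) :=
  Finset.univ.image T.α ∪ Finset.univ.image (T.β 1) ∪ Finset.univ.image T.γ

theorem card_S' : T.S'.card = p + 2 := by
  have hd := T.distinct
  have hα : Function.Injective T.α := T.α_lt.injective
  have hβ : Function.Injective (T.β 1) := (T.β_lt 1).injective
  have hγ : Function.Injective T.γ := T.γ_lt.injective
  have h1 : Disjoint (Finset.univ.image T.α) (Finset.univ.image (T.β 1)) := by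
    rw [Finset.disjoint_left]
    intro x hx hy
    obtain ⟨i, -, rfl⟩ := Finset.mem_image.1 hx
    obtain ⟨j, -, hj⟩ := Finset.mem_image.1 hy
    have := @hd (Sum.inr (Sum.inl (1, j))) (Sum.inl i) hj
    simp at this
  have h2 : Disjoint (Finset.univ.image T.α ∪ Finset.univ.image (T.β 1))
      (Finset.univ.image T.γ) := by
    rw [Finset.disjoint_left]
    intro x hx hy
    obtain ⟨j, -, rfl⟩ := Finset.mem_image.1 hy
    rcases Finset.mem_union.1 hx with hx | hx
    · obtain ⟨i, -, hi⟩ := Finset.mem_image.1 hx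
      have := @hd (Sum.inl i) (Sum.inr (Sum.inr j)) hi
      simp at this
    · obtain ⟨i, -, hi⟩ := Finset.mem_image.1 hx
      have := @hd (Sum.inr (Sum.inl (1, i))) (Sum.inr (Sum.inr j)) hi
      simp at this
  have := T.m_le
  rw [S', Finset.card_union_of_disjoint h2, Finset.card_union_of_disjoint h1,
    Finset.card_image_of_injective _ hα, Finset.card_image_of_injective _ hβ,
    Finset.card_image_of_injective _ hγ]
  simp only [Finset.card_univ, Fintype.card_fin]
  omega

/-- The increasing enumeration `ξ₁ < ⋯ < ξ_{p+2}` of `S'`. -/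
def ξ (j : Fin (p + 2)) : Fin n := T.S'.orderEmbOfFin T.card_S' j

/-- The linear map `X : k^n → k^{p+2}` with `X e_i = e_j` if `i = ξ_j` or if `i = β_l⁰` and
`β_l¹ = ξ_j` for some `l`, and `X e_i = 0` if there is no such `j`. (For each `i` there is at
most one such `j`; the matrix of `X` is given by its entries in row `j` and column `i`.) -/
def X (k : Type*) [Field k] : (Fin n → k) →ₗ[k] (Fin (p + 2) → k) :=
  Matrix.toLin' (Matrix.of fun (j : Fin (p + 2)) (i : Fin n) =>
    if i = T.ξ j ∨ ∃ l, i = T.β 0 l ∧ T.β 1 l = T.ξ j then (1 : k) else 0)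

open Classical in
/-- The linear map `Z : k^{p+2} → k^4` with `Z e_i = e_j` if `e_i = X e_{α_j}`, and `Z e_i = 0`
if there is no such `j`. -/
noncomputable def Z (k : Type*) [Field k] : (Fin (p + 2) → k) →ₗ[k] (Fin 4 → k) :=
  Matrix.toLin' (Matrix.of fun (j : Fin 4) (i : Fin (p + 2)) =>
    if (Pi.single i 1 : Fin (p + 2) → k) = T.X k (Pi.single (T.α j) 1) then (1 : k) else 0)

/-- The map `G = ⋀²Z ∘ δ ∘ ⋀^p X : ⋀^p k^n → ⋀² k^4`. -/
noncomputable def G (k : Type*) [Field k] :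
    (⋀[k]^p (Fin n → k)) →ₗ[k] (⋀[k]^2 (Fin 4 → k)) :=
  exteriorPower.map 2 (T.Z k) ∘ₗ
    (dualIso k (rfl : p + 2 = p + 2)).toLinearMap ∘ₗ exteriorPower.map p (T.X k)

end IndexTriple

end GrassmannCone

/-! In `⋀² k⁴` decomposability is the single Plücker relation `pf = 0` (`isDecomposable_iff_pf`).
For decomposable `ω` the coordinates of `G ω` are maximal minors of a `p × (p+2)` matrix, hence up
to sign determinants with two unit rows adjoined. These satisfy the three-term relation
(`detTwo_relation`), and the signs lost in the unsigned `δ` form a common factor of its three terms,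
so `G` preserves the cone (`isGCP_G`).

Conversely, let `ω` be indecomposable, with a nonzero coordinate at an index set `I`. Some
decomposable `ω'` has the same coordinates as `ω` at every index set differing from `I` in at most
one element. Since `ω ≠ ω'`, choose `J` with `ω_J ≠ ω'_J` and `|J \ I| = m + 2` minimal. Write `I \
J = {x_l}` and `J \ I = {y_l}` in increasing order. Let `𝒜` be the last two `x` and the last two
`y`; each earlier pair `x_l, y_l` is either merged by `X` (a pair of `ℬ`) or replaced by `y_l` alone
(an element of `𝒞`), and `I ∩ J` goes to `𝒞`.

Expanding the merged forms, each term of a coordinate of `G (ω - ω')` that uses some merged `x_l`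
has too few indices outside `I`, so it vanishes by minimality. Hence `G ω` and `G ω'` differ only in
the coordinate omitting both `x` in `𝒜`, by `±(ω - ω')_J ≠ 0`. In `pf` this coordinate is multiplied
by the one omitting both `y`, and that factor is nonzero for a suitable choice of merged pairs,
because `ω_I ≠ 0` (`exists_subset_multilinear_ne_zero`). As `pf (G ω') = 0`, it follows that `pf (G
ω) ≠ 0`. -/

namespace GrassmannCone

/-! ### Elements of `⋀^p V` as alternating forms on the dual space. -/

section Pairing

variable {k V V' : Type*} [Field k] [AddCommGroup V] [Module k V] [AddCommGroup V'] [Module k V']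
  {p : ℕ}

/-- The alternating form on the dual space of `V` defined by an element of `⋀^p V`. -/
noncomputable def pairing (ω : ⋀[k]^p V) : Module.Dual k V [⋀^Fin p]→ₗ[k] k :=
  (LinearMap.applyₗ ω).compAlternatingMap (exteriorPower.alternatingMapToDual k V p)

theorem pairing_ιMulti (v : Fin p → V) (φ : Fin p → Module.Dual k V) :
    pairing (exteriorPower.ιMulti k p v) φ = (Matrix.of fun i j => φ j (v i)).det := by
  simp [pairing]

theorem pairing_sub (ω ω' : ⋀[k]^p V) (φ : Fin p → Module.Dual k V) :
    pairing (ω - ω') φ = pairing ω φ - pairing ω' φ := by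
  simp [pairing]

theorem pairing_map (f : V →ₗ[k] V') (ω : ⋀[k]^p V) (φ : Fin p → Module.Dual k V') :
    pairing (exteriorPower.map p f ω) φ = pairing ω (fun i => φ i ∘ₗ f) := by
  have : (exteriorPower.alternatingMapToDual k V' p φ) ∘ₗ exteriorPower.map p f =
      exteriorPower.alternatingMapToDual k V p (fun i => φ i ∘ₗ f) := by
    ext v
    simp
  exact LinearMap.congr_fun this ω

end Pairing

/-! ### Plücker coordinates and the effect of `δ` on them. -/

section Coordinates

variable {k : Type*} [Field k] {N p : ℕ}

theorem wedgeBasis_repr (ω : ⋀[k]^p (Fin N → k)) (s : Set.powersetCard (Fin N) p) :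
    (wedgeBasis k N p).repr ω s =
      pairing ω (fun i => LinearMap.proj (s.1.orderEmbOfFin s.2 i)) := by
  rw [wedgeBasis, exteriorPower.basis_repr_apply, exteriorPower.ιMultiDual,
    exteriorPower.pairingDual, exteriorPower.ιMulti_family,
    exteriorPower.alternatingMapLinearEquiv_apply_ιMulti]
  simp only [pairing, LinearMap.compAlternatingMap_apply, LinearMap.applyₗ_apply_apply]
  congr 2

theorem eq_of_pairing_eq {ω ω' : ⋀[k]^p (Fin N → k)}
    (h : ∀ f : Fin p → Fin N, StrictMono f →
      pairing ω (fun i => LinearMap.proj (f i)) = pairing ω' (fun i => LinearMap.proj (f i))) :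
    ω = ω' := by
  apply (wedgeBasis k N p).repr.injective
  ext s
  rw [wedgeBasis_repr, wedgeBasis_repr]
  exact h _ (Finset.orderEmbOfFin _ _).strictMono

theorem dualIso_repr {q : ℕ} (h : p + q = N) (ω : ⋀[k]^p (Fin N → k))
    (s : Set.powersetCard (Fin N) p) (t : Set.powersetCard (Fin N) q) (hst : t.1 = s.1ᶜ) :
    (wedgeBasis k N q).repr (dualIso k h ω) t = (wedgeBasis k N p).repr ω s := by
  have ht : t = Set.powersetCard.compl (by rw [Fintype.card_fin, ← h, Nat.add_comm]) s := by
    apply Subtype.ext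
    rw [hst]
    rfl
  subst ht
  set e : Set.powersetCard (Fin N) p ≃ Set.powersetCard (Fin N) q := Set.powersetCard.compl
    (by rw [Fintype.card_fin, ← h, Nat.add_comm])
  have h1 : (wedgeBasis k N q).repr (dualIso k h ω) (e s) =
      ((wedgeBasis k N q).reindex e.symm).repr (dualIso k h ω) s := by simp
  rw [h1]
  -- The map `Basis.equiv` is by definition the coordinates in the first basis followed by inverse
  -- coordinates in the reindexed second one.
  change ((wedgeBasis k N q).reindex e.symm).repr
    (((wedgeBasis k N q).reindex e.symm).repr.symm ((wedgeBasis k N p).repr ω)) s = _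
  rw [LinearEquiv.apply_symm_apply]

/-- Injective enumerations of the same set of indices give the same value up to sign. -/
theorem alternating_eq_zero_iff_of_range_subset {U ι : Type*} [AddCommGroup U] [Module k U]
    (W : U [⋀^Fin p]→ₗ[k] k) (H : ι → U) {f g : Fin p → ι} (hf : Function.Injective f)
    (hfg : ∀ i, f i ∈ Set.range g) :
    W (fun i => H (f i)) = 0 ↔ W (fun i => H (g i)) = 0 := by
  choose σ hσ using hfg
  have hinj : Function.Injective σ := fun i j hij => hf (by rw [← hσ, ← hσ, hij])
  let e : Equiv.Perm (Fin p) := Equiv.ofBijective σ (Finite.injective_iff_bijective.1 hinj)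
  have h1 : (fun i => H (f i)) = (fun i => H (g i)) ∘ e := by
    ext i
    simp [e, hσ]
  rw [h1, AlternatingMap.map_perm, smul_eq_zero_iff_eq]

end Coordinates

/-! ### Decomposability in `⋀² k⁴`. -/

section Pfaffian

variable {k : Type*} [Field k]

/-- The coordinate of `e_a ∧ e_b`. -/
noncomputable def coord₂ (η : ⋀[k]^2 (Fin 4 → k)) (a b : Fin 4) : k :=
  pairing η ![LinearMap.proj a, LinearMap.proj b]

theorem coord₂_ιMulti (v : Fin 2 → Fin 4 → k) (a b : Fin 4) :
    coord₂ (exteriorPower.ιMulti k 2 v) a b = v 0 a * v 1 b - v 0 b * v 1 a := by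
  simp [coord₂, pairing_ιMulti, Matrix.det_fin_two]

theorem eq_of_coord₂_eq {η η' : ⋀[k]^2 (Fin 4 → k)}
    (h : ∀ a b, a < b → coord₂ η a b = coord₂ η' a b) : η = η' := by
  apply eq_of_pairing_eq
  intro f hf
  have := h (f 0) (f 1) (hf (by simp))
  rw [coord₂, coord₂] at this
  convert this using 2 <;> (ext i : 1; fin_cases i <;> rfl)

/-- The Plücker quadric on `⋀² k⁴`. -/
noncomputable def pf (η : ⋀[k]^2 (Fin 4 → k)) : k :=
  coord₂ η 0 1 * coord₂ η 2 3 - coord₂ η 0 2 * coord₂ η 1 3 + coord₂ η 0 3 * coord₂ η 1 2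

/-- For the converse, take `v` to be the contraction of `η` with the first coordinate form. If `v ≠
0`, a vector `w` with first entry `-1` can be solved for, and `pf η = 0` supplies the one remaining
coordinate. If `v = 0`, then `η` lies in `⋀²` of a three-dimensional space, where everything is
decomposable. -/
theorem isDecomposable_iff_pf (η : ⋀[k]^2 (Fin 4 → k)) : IsDecomposable η ↔ pf η = 0 := by
  constructor
  · rintro ⟨v, rfl⟩
    simp only [pf, coord₂_ιMulti]
    ring
  · intro h
    have key : ∀ v w : Fin 4 → k, (∀ a b, a < b → coord₂ η a b = v a * w b - v b * w a) →
        IsDecomposable η := fun v w hvw =>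
      ⟨![v, w], eq_of_coord₂_eq fun a b hab => by simp [coord₂_ιMulti, hvw a b hab]⟩
    rw [pf] at h
    generalize ha : coord₂ η 0 1 = x01 at h
    generalize hb : coord₂ η 0 2 = x02 at h
    generalize hc : coord₂ η 0 3 = x03 at h
    generalize hd : coord₂ η 1 2 = x12 at h
    generalize he : coord₂ η 1 3 = x13 at h
    generalize hf : coord₂ η 2 3 = x23 at h
    have key2 : ∀ v w : Fin 4 → k, x01 = v 0 * w 1 - v 1 * w 0 → x02 = v 0 * w 2 - v 2 * w 0 →
        x03 = v 0 * w 3 - v 3 * w 0 → x12 = v 1 * w 2 - v 2 * w 1 →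
        x13 = v 1 * w 3 - v 3 * w 1 → x23 = v 2 * w 3 - v 3 * w 2 → IsDecomposable η := by
      intro v w h1 h2 h3 h4 h5 h6
      apply key v w
      intro a b hab
      fin_cases a <;> fin_cases b <;> simp at hab <;> simp [*]
    by_cases h01 : x01 = 0
    swap
    · apply key2 ![0, x01, x02, x03] ![-1, 0, x12 / x01, x13 / x01] <;> simp <;> field_simp
      linear_combination h
    by_cases h02 : x02 = 0
    swap
    · apply key2 ![0, x01, x02, x03] ![-1, -x12 / x02, 0, x23 / x02] <;> simp <;> field_simp
      linear_combination -h
    by_cases h03 : x03 = 0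
    swap
    · apply key2 ![0, x01, x02, x03] ![-1, -x13 / x03, -x23 / x03, 0] <;> simp <;> field_simp
      linear_combination h
    subst h01 h02 h03
    by_cases h12 : x12 = 0
    swap
    · apply key2 ![0, 0, x12, x13] ![0, -1, 0, x23 / x12] <;> simp <;> field_simp
    by_cases h13 : x13 = 0
    swap
    · apply key2 ![0, 0, x12, x13] ![0, -1, -x23 / x13, 0] <;> simp <;> field_simp
    subst h12 h13
    apply key2 ![0, 0, 1, 0] ![0, 0, 0, x23] <;> simp

theorem isGCP_of_pf {V : Type*} [AddCommGroup V] [Module k V] {p : ℕ}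
    {F : ⋀[k]^p V →ₗ[k] ⋀[k]^2 (Fin 4 → k)}
    (h : ∀ v : Fin p → V, pf (F (exteriorPower.ιMulti k p v)) = 0) : IsGCP F := by
  rintro _ ⟨_, ⟨v, rfl⟩, rfl⟩
  exact (isDecomposable_iff_pf _).2 (h v)

end Pfaffian

/-! ### The three-term Plücker relation for maximal minors. -/

section Minors

variable {R : Type*} [CommRing R] {p : ℕ}

/-- The `(p+2) × (p+2)` determinant with the first two rows `a`, `b`. -/
def detTwo (u : Fin p → Fin (p + 2) → R) (a b : Fin (p + 2) → R) : R :=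
  Matrix.det (Matrix.of (Matrix.vecCons a (Matrix.vecCons b u)))

theorem detTwo_self_right (u : Fin p → Fin (p + 2) → R) (a b : Fin (p + 2) → R)
    (h : b = a ∨ ∃ i, b = u i) : detTwo u a b = 0 := by
  rcases h with rfl | ⟨i, rfl⟩
  · exact Matrix.det_zero_of_row_eq (i := 0) (j := 1) (by simp) rfl
  · exact Matrix.det_zero_of_row_eq (i := 1) (j := i.succ.succ)
      (by simp [Fin.ext_iff]) rfl

theorem detTwo_swap (u : Fin p → Fin (p + 2) → R) (a b : Fin (p + 2) → R) :
    detTwo u a b = - detTwo u b a := by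
  have h := (Matrix.detRowAlternating (n := Fin (p + 2)) (R := R)).map_swap
    (Matrix.vecCons b (Matrix.vecCons a u)) (i := 0) (j := 1) (by simp)
  rw [detTwo, detTwo]
  refine Eq.trans ?_ h
  change Matrix.det _ = Matrix.det _
  congr 1
  ext i j
  refine Fin.cases ?_ (fun i => Fin.cases ?_ (fun i => ?_) i) i
  · simp
  · simp
  · simp [Equiv.swap_apply_of_ne_of_ne, Fin.ext_iff]

/-- Cramer's rule expands `det M • b` in the rows `c`, `d`, `u i` of `M`. The linear form `x ↦
detTwo u a x` kills the rows `u i`, so applying it leaves three terms. -/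
theorem detTwo_relation (u : Fin p → Fin (p + 2) → R) (a b c d : Fin (p + 2) → R) :
    detTwo u a b * detTwo u c d - detTwo u a c * detTwo u b d + detTwo u a d * detTwo u b c
      = 0 := by
  set M : Matrix (Fin (p + 2)) (Fin (p + 2)) R :=
    Matrix.of (Matrix.vecCons c (Matrix.vecCons d u)) with hM
  let L : (Fin (p + 2) → R) →ₗ[R] R :=
    (Matrix.detRowAlternating (n := Fin (p + 2)) (R := R)).toMultilinearMap.toLinearMap
      (Matrix.vecCons a (Matrix.vecCons 0 u)) 1
  have hL : ∀ x, L x = detTwo u a x := by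
    intro x
    simp only [L, MultilinearMap.toLinearMap_apply, detTwo]
    change Matrix.det _ = _
    congr 1
    ext i j
    refine Fin.cases ?_ (fun i => Fin.cases ?_ (fun i => ?_) i) i
    · simp [Function.update]
    · simp [Function.update]
    · simp [Function.update, Fin.ext_iff]
  have h1 : ∑ i, (M.updateRow i b).det • M i = M.det • b := by
    have h2 := Matrix.mulVec_cramer M.transpose b
    rw [Matrix.det_transpose] at h2
    rw [← h2]
    ext j
    simp [Matrix.mulVec, dotProduct, Matrix.cramer_transpose_apply, mul_comm]
  have h3 := congrArg L h1
  simp only [map_sum, map_smul] at h3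
  rw [Fin.sum_univ_succ, Fin.sum_univ_succ] at h3
  simp only [hL, smul_eq_mul] at h3
  have h4 : ∀ i : Fin p, detTwo u a (M i.succ.succ) = 0 := fun i =>
    detTwo_self_right _ _ _ (Or.inr ⟨i, rfl⟩)
  simp only [h4, mul_zero, Finset.sum_const_zero, add_zero] at h3
  have h5 : (M.updateRow 0 b).det = detTwo u b d := by
    rw [detTwo]
    congr 1
    ext i j
    refine Fin.cases ?_ (fun i => ?_) i
    · simp
    · simp [hM, Matrix.updateRow_apply]
  have h6 : (M.updateRow (Fin.succ 0) b).det = - detTwo u b c := by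
    rw [detTwo_swap, neg_neg, detTwo]
    congr 1
    ext i j
    refine Fin.cases ?_ (fun i => Fin.cases ?_ (fun i => ?_) i) i
    · simp [hM, Matrix.updateRow_apply]
    · simp [Matrix.updateRow_apply]
    · simp [hM, Matrix.updateRow_apply, Fin.ext_iff]
  have h7 : M 0 = c := rfl
  have h8 : M (Fin.succ 0) = d := rfl
  have h9 : M.det = detTwo u c d := rfl
  rw [h5, h6, h7, h8, h9] at h3
  linear_combination -h3

/-- Laplace expansion along the two unit rows. Once column `s` is deleted, column `t > s` sits at
position `t - 1`, which accounts for the extra `1` in the exponent. -/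
theorem detTwo_single (u : Fin p → Fin (p + 2) → R) {s t : Fin (p + 2)} (hst : s < t)
    (K : Finset (Fin (p + 2))) (hK : K.card = p) (hKc : K = {s, t}ᶜ) :
    detTwo u (Pi.single s 1) (Pi.single t 1) =
      (-1) ^ (s.val + t.val + 1) * (Matrix.of fun i j => u i (K.orderEmbOfFin hK j)).det := by
  have ht : t ≠ 0 := (lt_of_le_of_lt (Fin.zero_le _) hst).ne'
  obtain ⟨t', ht'⟩ := Fin.exists_succAbove_eq hst.ne'
  have htv : t.val = t'.val + 1 := by
    rw [← ht']
    have : ¬ t'.castSucc < s := by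
      intro hlt
      rw [Fin.succAbove_of_castSucc_lt _ _ hlt] at ht'
      exact absurd (ht' ▸ hlt) (not_lt.2 hst.le)
    rw [Fin.succAbove_of_le_castSucc _ _ (not_lt.1 this)]
    simp
  have hemb : ∀ j, K.orderEmbOfFin hK j = s.succAbove (t'.succAbove j) := by
    intro j
    have := Finset.orderEmbOfFin_unique hK (f := fun j => s.succAbove (t'.succAbove j))
      (fun x => by
        simp only [hKc, Finset.mem_compl, Finset.mem_insert, Finset.mem_singleton, not_or]
        refine ⟨Fin.succAbove_ne _ _, ?_⟩
        rw [← ht']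
        exact fun h => Fin.succAbove_ne _ _ (Fin.succAbove_right_injective h))
      ((Fin.strictMono_succAbove s).comp (Fin.strictMono_succAbove t'))
    rw [← this]
  rw [detTwo, Matrix.det_succ_row_zero, Finset.sum_eq_single s]
  rotate_left
  · intro j _ hj
    simp [Pi.single_apply, hj]
  · simp
  rw [Matrix.det_succ_row_zero, Finset.sum_eq_single t']
  rotate_left
  · intro j _ hj
    have : s.succAbove j ≠ t := by
      rw [← ht']
      exact fun h => hj (Fin.succAbove_right_injective h)
    simp [this]
  · simp
  simp only [Matrix.of_apply, Matrix.cons_val_zero, Pi.single_eq_same, mul_one,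
    Matrix.submatrix_apply, ht', Matrix.cons_val_succ, Matrix.submatrix_submatrix]
  rw [htv, ← mul_assoc, ← pow_add]
  congr 1
  · rw [show s.val + (t'.val + 1) + 1 = s.val + t'.val + 2 by ring, pow_add _ _ 2]
    simp
  · congr 1
    ext i j
    simp [hemb]

end Minors

/-! ### The coordinates of `G ω`, and `G` preserves the cone. -/

namespace IndexTriple

variable {p n : ℕ} (T : IndexTriple p n)

theorem mem_S'_iff {x : Fin n} :
    x ∈ T.S' ↔ (∃ a, T.α a = x) ∨ (∃ l, T.β 1 l = x) ∨ ∃ i, T.γ i = x := by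
  simp [S']

theorem α_mem_S' (a : Fin 4) : T.α a ∈ T.S' := T.mem_S'_iff.2 (Or.inl ⟨a, rfl⟩)

theorem β_zero_notMem_S' (l : Fin T.m) : T.β 0 l ∉ T.S' := by
  rw [mem_S'_iff]
  rintro (⟨a, h⟩ | ⟨i, h⟩ | ⟨i, h⟩)
  · simpa using @T.distinct (Sum.inl a) (Sum.inr (Sum.inl (0, l))) h
  · simpa using @T.distinct (Sum.inr (Sum.inl (1, i))) (Sum.inr (Sum.inl (0, l))) h
  · simpa using @T.distinct (Sum.inr (Sum.inr i)) (Sum.inr (Sum.inl (0, l))) h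

theorem β_one_ne_α (l : Fin T.m) (a : Fin 4) : T.β 1 l ≠ T.α a := fun h => by
  simpa using @T.distinct (Sum.inr (Sum.inl (1, l))) (Sum.inl a) h

theorem ξ_mem_S' (t : Fin (p + 2)) : T.ξ t ∈ T.S' := Finset.orderEmbOfFin_mem _ _ _

theorem ξ_strictMono : StrictMono T.ξ := (T.S'.orderEmbOfFin T.card_S').strictMono

theorem exists_ξ_eq {x : Fin n} (hx : x ∈ T.S') : ∃ t, T.ξ t = x := by
  have := Finset.range_orderEmbOfFin T.S' T.card_S'
  rw [← Finset.mem_coe, ← this] at hx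
  exact hx

/-- The position of `α_a` in the increasing enumeration of `S'`. -/
noncomputable def ζ (a : Fin 4) : Fin (p + 2) := (T.exists_ξ_eq (T.α_mem_S' a)).choose

theorem ξ_ζ (a : Fin 4) : T.ξ (T.ζ a) = T.α a := (T.exists_ξ_eq (T.α_mem_S' a)).choose_spec

theorem ζ_strictMono : StrictMono T.ζ := fun a b hab => by
  rw [← T.ξ_strictMono.lt_iff_lt, ξ_ζ, ξ_ζ]
  exact T.α_lt hab

variable (k : Type*) [Field k]

/-- The linear form `e_x^*`, or `e_x^* + e_{β_l⁰}^*` if `x = β_l¹`. -/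
noncomputable def form (x : Fin n) : Module.Dual k (Fin n → k) :=
  LinearMap.proj x + ∑ l, if T.β 1 l = x then LinearMap.proj (T.β 0 l) else 0

theorem form_of_forall_ne {x : Fin n} (h : ∀ l, T.β 1 l ≠ x) : T.form k x = (LinearMap.proj x : Module.Dual k (Fin n → k)) := by
  simp [form, h]

theorem form_β (l : Fin T.m) :
    T.form k (T.β 1 l) =
      (LinearMap.proj (T.β 1 l) : Module.Dual k (Fin n → k)) + LinearMap.proj (T.β 0 l) := by
  simp [form, (T.β_lt 1).injective.eq_iff]

theorem proj_comp_X (t : Fin (p + 2)) : LinearMap.proj t ∘ₗ T.X k = T.form k (T.ξ t) := by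
  apply LinearMap.pi_ext'
  intro i
  ext
  simp only [X, LinearMap.comp_apply, LinearMap.proj_apply, Matrix.toLin'_apply,
    LinearMap.single_apply, Matrix.mulVec_single_one, Matrix.col_apply, Matrix.of_apply]
  by_cases h : ∃ l, T.β 1 l = T.ξ t
  · obtain ⟨l, hl⟩ := h
    rw [← hl, form_β]
    have hne : T.β 1 l ≠ T.β 0 l := fun h => T.β_zero_notMem_S' l (h ▸ hl ▸ T.ξ_mem_S' t)
    by_cases h1 : i = T.β 1 l
    · subst h1
      simp [hne]
    · by_cases h2 : i = T.β 0 l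
      · subst h2
        rw [if_pos (Or.inr ⟨l, rfl, rfl⟩)]
        simp [hne]
      · rw [if_neg]
        · simp [Ne.symm h1, Ne.symm h2]
        · rintro (h | ⟨l', h, h'⟩)
          · exact h1 h
          · exact h2 ((T.β_lt 1).injective h' ▸ h)
  · push Not at h
    rw [form_of_forall_ne _ _ h]
    simp [h, Pi.single_apply, eq_comm]

theorem X_single_α (a : Fin 4) : T.X k (Pi.single (T.α a) 1) = Pi.single (T.ζ a) 1 := by
  ext t
  have h := LinearMap.congr_fun (T.proj_comp_X k t) (Pi.single (T.α a) 1)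
  simp only [LinearMap.comp_apply, LinearMap.proj_apply] at h
  rw [h]
  by_cases h1 : ∃ l, T.β 1 l = T.ξ t
  · obtain ⟨l, hl⟩ := h1
    have h2 : t ≠ T.ζ a := by
      rintro rfl
      exact T.β_one_ne_α l a (hl.trans (T.ξ_ζ a))
    have h3 : T.β 0 l ≠ T.α a := fun h => T.β_zero_notMem_S' l (h ▸ T.α_mem_S' a)
    rw [← hl, form_β]
    simp [h2, h3, T.β_one_ne_α]
  · push Not at h1
    rw [form_of_forall_ne _ _ h1]
    simp [Pi.single_apply, ← T.ξ_ζ, T.ξ_strictMono.injective.eq_iff]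

theorem proj_comp_Z (a : Fin 4) : LinearMap.proj a ∘ₗ T.Z k = LinearMap.proj (T.ζ a) := by
  apply LinearMap.pi_ext'
  intro i
  ext
  have : (Pi.single i 1 : Fin (p + 2) → k) = Pi.single (T.ζ a) 1 ↔ i = T.ζ a := by
    constructor
    · intro h
      by_contra hne
      have := congrFun h i
      simp [hne] at this
    · rintro rfl; rfl
  simp only [Z, LinearMap.comp_apply, LinearMap.proj_apply, Matrix.toLin'_apply,
    LinearMap.single_apply, Matrix.mulVec_single_one, Matrix.col_apply, Matrix.of_apply]
  by_cases hi : i = T.ζ a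
  · rw [if_pos (by convert (this.2 hi).trans (T.X_single_α k a).symm)]
    simp [hi]
  · rw [if_neg (fun h => hi (this.1 ?_)), Pi.single_eq_of_ne (Ne.symm hi)]
    rw [← T.X_single_α k a]
    convert h

/-- Pulling back along `Z` turns the coordinates `a, b` into `ζ a, ζ b`, and `δ` passes to the
complementary `p`-set without a sign. -/
theorem coord₂_G {a b : Fin 4} (hab : a < b) (K : Finset (Fin (p + 2))) (hK : K.card = p)
    (hKc : K = {T.ζ a, T.ζ b}ᶜ) (ω : ⋀[k]^p (Fin n → k)) :
    coord₂ (T.G k ω) a b = pairing (exteriorPower.map p (T.X k) ω)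
      (fun i => LinearMap.proj (K.orderEmbOfFin hK i)) := by
  have hlt := T.ζ_strictMono hab
  have hcard : ({T.ζ a, T.ζ b} : Finset (Fin (p + 2))).card = 2 := Finset.card_pair hlt.ne
  rw [← wedgeBasis_repr _ ⟨K, hK⟩,
    ← dualIso_repr (rfl : p + 2 = p + 2) _ ⟨K, hK⟩ ⟨{T.ζ a, T.ζ b}, hcard⟩ (by simp [hKc]),
    wedgeBasis_repr, coord₂, G, LinearMap.comp_apply, LinearMap.comp_apply, pairing_map]
  change pairing (dualIso k _ _) _ = _
  congr 1
  have := Finset.orderEmbOfFin_unique hcard (f := ![T.ζ a, T.ζ b])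
    (by intro i; fin_cases i <;> simp) (by
      intro i j hij
      fin_cases i <;> fin_cases j <;> simp_all)
  ext i : 1
  simp only [← this]
  fin_cases i
  · simpa using T.proj_comp_Z k a
  · simpa using T.proj_comp_Z k b

theorem card_compl_pair {a b : Fin 4} (hab : a < b) :
    ({T.ζ a, T.ζ b}ᶜ : Finset (Fin (p + 2))).card = p := by
  rw [Finset.card_compl, Finset.card_pair (T.ζ_strictMono hab).ne]
  simp

/-- Only the range of `κ` is recorded: it fixes the coordinate up to a sign independent of `ω`,
which is enough for vanishing arguments and for comparing two elements. -/
theorem exists_coord₂_G_eq {a b : Fin 4} (hab : a < b) :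
    ∃ κ : Fin p → Fin n, Function.Injective κ ∧
      (∀ x, x ∈ Set.range κ ↔ x ∈ T.S' ∧ x ≠ T.α a ∧ x ≠ T.α b) ∧
      ∀ ω : ⋀[k]^p (Fin n → k),
        coord₂ (T.G k ω) a b = pairing ω (fun i => T.form k (κ i)) := by
  have hK := T.card_compl_pair hab
  refine ⟨fun i => T.ξ (Finset.orderEmbOfFin _ hK i),
    T.ξ_strictMono.injective.comp (Finset.orderEmbOfFin _ hK).injective, fun x => ?_, fun ω => ?_⟩
  · constructor
    · rintro ⟨i, rfl⟩
      have := Finset.orderEmbOfFin_mem _ hK i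
      simp only [Finset.mem_compl, Finset.mem_insert, Finset.mem_singleton, not_or] at this
      rw [← T.ξ_ζ a, ← T.ξ_ζ b, T.ξ_strictMono.injective.ne_iff, T.ξ_strictMono.injective.ne_iff]
      exact ⟨T.ξ_mem_S' _, this⟩
    · rintro ⟨hx, ha, hb⟩
      obtain ⟨t, rfl⟩ := T.exists_ξ_eq hx
      rw [← T.ξ_ζ a, T.ξ_strictMono.injective.ne_iff] at ha
      rw [← T.ξ_ζ b, T.ξ_strictMono.injective.ne_iff] at hb
      have ht : t ∈ (({T.ζ a, T.ζ b}ᶜ : Finset (Fin (p + 2))) : Set (Fin (p + 2))) := by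
        simp [ha, hb]
      rw [← Finset.range_orderEmbOfFin _ hK] at ht
      obtain ⟨i, rfl⟩ := ht
      exact ⟨i, rfl⟩
  · rw [T.coord₂_G k hab _ hK rfl, pairing_map]
    simp only [proj_comp_X]

/-- Each of the three products in `pf` involves all four `ζ a` once, so all three carry the same
sign relative to `detTwo_relation`. -/
theorem pf_G_ιMulti (v : Fin p → Fin n → k) : pf (T.G k (exteriorPower.ιMulti k p v)) = 0 := by
  set u : Fin p → Fin (p + 2) → k := fun i => T.X k (v i)
  have key : ∀ a b : Fin 4, a < b → coord₂ (T.G k (exteriorPower.ιMulti k p v)) a b =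
      (-1) ^ ((T.ζ a).val + (T.ζ b).val + 1) *
        detTwo u (Pi.single (T.ζ a) 1) (Pi.single (T.ζ b) 1) := by
    intro a b hab
    have hK := T.card_compl_pair hab
    rw [T.coord₂_G k hab _ hK rfl, exteriorPower.map_apply_ιMulti, pairing_ιMulti,
      detTwo_single u (T.ζ_strictMono hab) _ hK rfl, ← mul_assoc, ← mul_pow]
    simp [u]
  have h := detTwo_relation u (Pi.single (T.ζ 0) 1) (Pi.single (T.ζ 1) 1) (Pi.single (T.ζ 2) 1)
    (Pi.single (T.ζ 3) 1)
  rw [pf, key 0 1 (by decide), key 0 2 (by decide), key 0 3 (by decide), key 1 2 (by decide),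
    key 1 3 (by decide), key 2 3 (by decide)]
  simp only [pow_add, pow_one]
  linear_combination ((-1) ^ (T.ζ 0).val * (-1) ^ (T.ζ 1).val * (-1) ^ (T.ζ 2).val *
    (-1) ^ (T.ζ 3).val) * h

theorem isGCP_G : IsGCP (T.G k) := isGCP_of_pf (T.pf_G_ιMulti k)

end IndexTriple

/-! ### Expanding (multi)linear forms at sums of vectors. -/

section Multilinear

variable {k U ι : Type*} [Field k] [AddCommGroup U] [Module k U] {p : ℕ}

/-- If an alternating form vanishes on all tuples of indices with fewer than `q` entries outside
`I`, then adding vectors indexed by `I` to vectors indexed outside `I` does not change its value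
on a tuple with at most `q` entries outside `I`. -/
theorem alternating_add_eq [DecidableEq ι] (Δ : U [⋀^Fin p]→ₗ[k] k) (e : ι → U) (I : Finset ι)
    (q : ℕ)
    (hΔ : ∀ g : Fin p → ι, (Finset.univ.filter fun s => g s ∉ I).card < q →
      Δ (fun s => e (g s)) = 0)
    (g : Fin p → ι) (w : Fin p → U)
    (hw : ∀ s, w s = 0 ∨ ∃ h ∈ I, g s ∉ I ∧ w s = e h)
    (hg : (Finset.univ.filter fun s => g s ∉ I).card ≤ q) :
    Δ (fun s => e (g s) + w s) = Δ (fun s => e (g s)) := by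
  have h1 := Δ.toMultilinearMap.map_add_univ (fun s => e (g s)) w
  have h2 : Δ (fun s => e (g s) + w s) =
      ∑ S : Finset (Fin p), Δ (S.piecewise (fun s => e (g s)) w) := h1
  -- In the term of `S`, the slots outside `S` carry `w`. Unless some such `w s` is zero, each of
  -- them trades an index outside `I` for one inside, so every term with `S ≠ univ` vanishes by
  -- `hΔ`.
  rw [h2, Finset.sum_eq_single Finset.univ]
  · simp
  · intro S _ hS
    by_cases h0 : ∃ s ∉ S, w s = 0
    · obtain ⟨s, hs, hs0⟩ := h0
      exact Δ.map_coord_zero s (by simp [hs, hs0])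
    · push Not at h0
      have h3 : ∀ s, ∃ h, s ∉ S → h ∈ I ∧ g s ∉ I ∧ w s = e h := by
        intro s
        by_cases hs : s ∈ S
        · exact ⟨g s, fun h => absurd hs h⟩
        · obtain ⟨h, hh⟩ := (hw s).resolve_left (h0 s hs)
          exact ⟨h, fun _ => hh⟩
      choose h hh using h3
      have h4 : S.piecewise (fun s => e (g s)) w = fun s => e (S.piecewise g h s) := by
        ext s
        by_cases hs : s ∈ S
        · simp [hs]
        · simp [hs, (hh s hs).2.2]
      rw [h4]
      apply hΔ
      refine lt_of_lt_of_le (Finset.card_lt_card ?_) hg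
      obtain ⟨t, ht⟩ : ∃ t, t ∉ S := by
        by_contra hcon
        push Not at hcon
        exact hS (Finset.eq_univ_iff_forall.2 hcon)
      rw [Finset.ssubset_iff_of_subset]
      · refine ⟨t, by simp [(hh t ht).2.1], by simp [ht, (hh t ht).1]⟩
      · intro s
        by_cases hs : s ∈ S
        · simp [hs]
        · simp [hs, (hh s hs).1]
  · simp

/-- In one slot `b = (a + b) - a`, so a nonzero value at `b` forces one at `a + b` or at `a`. Treat
the slots of `B` one after another. -/
theorem exists_subset_multilinear_ne_zero (W : MultilinearMap k (fun _ : Fin p => U) k)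
    (a b : Fin p → U) (h : W b ≠ 0) (B : Finset (Fin p)) :
    ∃ S : Finset (Fin p),
      W (fun s => if s ∈ B then (if s ∈ S then a s + b s else a s) else b s) ≠ 0 := by
  induction B using Finset.induction_on with
  | empty => exact ⟨∅, by simpa using h⟩
  | insert r B hr ih =>
    obtain ⟨S, hS⟩ := ih
    set v := fun s => if s ∈ B then (if s ∈ S then a s + b s else a s) else b s with hv
    have h1 : W (Function.update v r (a r + b r)) = W (Function.update v r (a r)) + W v := by
      rw [W.map_update_add]
      congr 2
      rw [Function.update_eq_self_iff]
      simp [hv, hr]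
    by_cases h2 : W (Function.update v r (a r)) = 0
    · refine ⟨insert r S, ?_⟩
      rw [h2, zero_add] at h1
      rw [← h1] at hS
      convert hS using 2
      ext s : 1
      by_cases hs : s = r
      · subst hs; simp
      · simp [hs, hv]
    · refine ⟨S.erase r, ?_⟩
      convert h2 using 2
      ext s : 1
      by_cases hs : s = r
      · subst hs; simp
      · simp [hs, hv]

end Multilinear

/-! ### The decomposable approximation `ω'`, and comparison of two Plücker relations. -/

section Candidate

variable {k : Type*} [Field k] {n p : ℕ}

theorem IsDecomposable.smul {V : Type*} [AddCommGroup V] [Module k V] (hp : 1 ≤ p) (c : k)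
    {ω : ⋀[k]^p V} (h : IsDecomposable ω) : IsDecomposable (c • ω) := by
  obtain ⟨v, rfl⟩ := h
  refine ⟨Function.update v ⟨0, hp⟩ (c • v ⟨0, hp⟩), ?_⟩
  rw [AlternatingMap.map_update_smul, Function.update_eq_self]

/-- A decomposable element with the same coordinates near a nonzero coordinate. -/
theorem exists_isDecomposable_pairing_eq (hp : 1 ≤ p) (ω : ⋀[k]^p (Fin n → k))
    (f : Fin p → Fin n) (hf : pairing ω (fun i => LinearMap.proj (f i)) ≠ 0) :
    ∃ ω' : ⋀[k]^p (Fin n → k), IsDecomposable ω' ∧ ∀ r y,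
      pairing ω' (fun i => LinearMap.proj (Function.update f r y i)) =
        pairing ω (fun i => LinearMap.proj (Function.update f r y i)) := by
  set c := pairing ω (fun i => LinearMap.proj (f i)) with hc
  -- Restricted to the columns `f`, the matrix of `v` is the identity. Changing column `r` to `y`
  -- thus gives the determinant `v r y`, which `c` rescales to the coordinate of `ω`.
  set v : Fin p → Fin n → k := fun i j =>
    c⁻¹ * pairing ω (fun s => LinearMap.proj (Function.update f i j s)) with hv
  refine ⟨c • exteriorPower.ιMulti k p v, IsDecomposable.smul hp c ⟨v, rfl⟩, fun r y => ?_⟩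
  have h1 : pairing (c • exteriorPower.ιMulti k p v)
      (fun i => LinearMap.proj (Function.update f r y i)) =
      c * pairing (exteriorPower.ιMulti k p v)
        (fun i => LinearMap.proj (Function.update f r y i)) := by
    simp [pairing]
  have h2 : (Matrix.of fun i j => (LinearMap.proj (R := k) (φ := fun _ : Fin n => k)
      (Function.update f r y j)) (v i)) =
      (1 : Matrix (Fin p) (Fin p) k).updateCol r (fun i => v i y) := by
    ext i j
    rw [Matrix.of_apply, LinearMap.proj_apply]
    by_cases hj : j = r
    · subst hj
      simp
    · rw [Function.update_of_ne hj, Matrix.updateCol_ne hj, hv]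
      by_cases hij : i = j
      · subst hij
        simp [← hc, hf]
      · rw [Matrix.one_apply_ne hij]
        simp only
        rw [AlternatingMap.map_eq_zero_of_eq _ _ (i := i) (j := j) _ hij, mul_zero]
        simp [Function.update_of_ne (Ne.symm hij)]
  rw [h1, pairing_ιMulti, h2, ← Matrix.cramer_apply, Matrix.cramer_one]
  simp [hv, hf]

/-- `pf` is affine in the coordinate `c, d`, with slope `±` the complementary coordinate `a, b`.
Subtracting the two relations leaves a product equal to zero. -/
theorem pf_eq_zero_imp {η η' : ⋀[k]^2 (Fin 4 → k)} (h : pf η = 0) (h' : pf η' = 0)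
    {a b c d : Fin 4} (hab : a < b) (hcd : c < d) (hac : a ≠ c) (had : a ≠ d) (hbc : b ≠ c)
    (hbd : b ≠ d)
    (heq : ∀ i j, i < j → (i, j) ≠ (c, d) → coord₂ η i j = coord₂ η' i j) :
    coord₂ η a b = 0 ∨ coord₂ η c d = coord₂ η' c d := by
  have hh : coord₂ η a b * (coord₂ η c d - coord₂ η' c d) = 0 := by
    rw [pf] at h h'
    have e01 := heq 0 1 (by decide)
    have e02 := heq 0 2 (by decide)
    have e03 := heq 0 3 (by decide)
    have e12 := heq 1 2 (by decide)
    have e13 := heq 1 3 (by decide)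
    have e23 := heq 2 3 (by decide)
    fin_cases a <;> fin_cases b <;> simp at hab <;> fin_cases c <;> simp at hac hbc <;>
      fin_cases d <;> simp at hcd had hbd <;>
      simp at e01 e02 e03 e12 e13 e23 <;> grind
  rcases mul_eq_zero.1 hh with h | h
  · exact Or.inl h
  · exact Or.inr (sub_eq_zero.1 h)

end Candidate

/-! ### Construction of the index triple from `I`, `J` and the set `S` of merged pairs. -/

section Matching

variable {n m : ℕ}

theorem finset_four_card {a b c d : Fin n} (hab : a ≠ b) (hac : a ≠ c) (had : a ≠ d) (hbc : b ≠ c)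
    (hbd : b ≠ d) (hcd : c ≠ d) : ({a, b, c, d} : Finset (Fin n)).card = 4 := by
  rw [Finset.card_insert_of_notMem, Finset.card_insert_of_notMem, Finset.card_pair hcd] <;>
    simp [*]

/-- Pairing off the `l`-th elements of two sequences, apart from the last two of each, gives an
index triple. -/
theorem exists_indexTriple {p : ℕ} (I J : Finset (Fin n)) (hJ : J.card = p)
    (x y : Fin (m + 2) → Fin n) (hx : StrictMono x) (hy : StrictMono y)
    (hxI : ∀ v, v ∈ Set.range x ↔ v ∈ I \ J) (hyJ : ∀ v, v ∈ Set.range y ↔ v ∈ J \ I)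
    (S : Finset (Fin m)) :
    ∃ T : IndexTriple p n,
      (∀ v, (∃ a, T.α a = v) ↔ v = x (Fin.natAdd m 0) ∨ v = x (Fin.natAdd m 1) ∨
        v = y (Fin.natAdd m 0) ∨ v = y (Fin.natAdd m 1)) ∧
      (∀ l ∈ S, ∃ i, T.β 0 i = min (x (Fin.castAdd 2 l)) (y (Fin.castAdd 2 l)) ∧
        T.β 1 i = max (x (Fin.castAdd 2 l)) (y (Fin.castAdd 2 l))) ∧
      (∀ i, ∃ l ∈ S, T.β 0 i = min (x (Fin.castAdd 2 l)) (y (Fin.castAdd 2 l)) ∧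
        T.β 1 i = max (x (Fin.castAdd 2 l)) (y (Fin.castAdd 2 l))) ∧
      (∀ v, (∃ i, T.γ i = v) ↔ v ∈ I ∩ J ∨ ∃ l ∉ S, v = y (Fin.castAdd 2 l)) := by
  have hxI' : ∀ i, x i ∈ I ∧ x i ∉ J := fun i => Finset.mem_sdiff.1 ((hxI _).1 ⟨i, rfl⟩)
  have hyJ' : ∀ i, y i ∈ J ∧ y i ∉ I := fun i => Finset.mem_sdiff.1 ((hyJ _).1 ⟨i, rfl⟩)
  have hxy : ∀ i j, x i ≠ y j := fun i j h => (hxI' i).2 (h ▸ (hyJ' j).1)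
  have h01 : (Fin.natAdd m (0 : Fin 2)) < Fin.natAdd m 1 := by simp
  have hlast : ∀ (l : Fin m) (c : Fin 2), Fin.castAdd 2 l < Fin.natAdd m c := fun l c => by
    simp only [Fin.lt_def, Fin.val_castAdd, Fin.val_natAdd]
    omega
  set x0 := x (Fin.natAdd m 0) with hx0
  set x1 := x (Fin.natAdd m 1) with hx1
  set y0 := y (Fin.natAdd m 0) with hy0
  set y1 := y (Fin.natAdd m 1) with hy1
  have hx01 : x0 < x1 := hx h01
  have hy01 : y0 < y1 := hy h01
  set A : Finset (Fin n) := {x0, x1, y0, y1} with hA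
  have hAcard : A.card = 4 := finset_four_card hx01.ne (hxy _ _) (hxy _ _) (hxy _ _) (hxy _ _)
    hy01.ne
  set lo : Fin m → Fin n := fun l => min (x (Fin.castAdd 2 l)) (y (Fin.castAdd 2 l)) with hlo
  set hi : Fin m → Fin n := fun l => max (x (Fin.castAdd 2 l)) (y (Fin.castAdd 2 l)) with hhi
  have hlo_mem : ∀ l, lo l = x (Fin.castAdd 2 l) ∨ lo l = y (Fin.castAdd 2 l) :=
    fun l => min_choice _ _
  have hhi_mem : ∀ l, hi l = x (Fin.castAdd 2 l) ∨ hi l = y (Fin.castAdd 2 l) :=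
    fun l => max_choice _ _
  have hlohi : ∀ l, lo l < hi l := fun l => min_lt_max.2 (hxy _ _)
  have hlo_mono : StrictMono lo := fun l l' h =>
    min_lt_min (hx (Fin.strictMono_castAdd 2 h)) (hy (Fin.strictMono_castAdd 2 h))
  have hhi_mono : StrictMono hi := fun l l' h =>
    max_lt_max (hx (Fin.strictMono_castAdd 2 h)) (hy (Fin.strictMono_castAdd 2 h))
  -- For `l ∉ S` the index `y_l` goes to `𝒞` while `x_l` is in none of the lists, so `X` kills its
  -- basis vector.
  set Γ : Finset (Fin n) := (I ∩ J) ∪ Sᶜ.image (fun l => y (Fin.castAdd 2 l)) with hΓ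
  have hmemΓ : ∀ v, v ∈ Γ ↔ v ∈ I ∩ J ∨ ∃ l ∉ S, v = y (Fin.castAdd 2 l) := by
    intro v
    simp [hΓ, eq_comm]
  have hJI : (J \ I).card = m + 2 := by
    have : J \ I = Finset.univ.image y := by
      ext v
      rw [← hyJ]
      simp
    rw [this, Finset.card_image_of_injective _ hy.injective]
    simp
  have hS : S.card ≤ m := by simpa using Finset.card_le_univ S
  have hIJ : (I ∩ J).card + (m + 2) = p := by
    rw [← hJI, Finset.inter_comm, Finset.card_inter_add_card_sdiff, hJ]
  have hΓcard : Γ.card = p - S.card - 2 := by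
    rw [hΓ, Finset.card_union_of_disjoint, Finset.card_image_of_injective, Finset.card_compl,
      Fintype.card_fin]
    · omega
    · exact hy.injective.comp (Fin.castAdd_injective m 2)
    · rw [Finset.disjoint_left]
      intro v hv hv'
      obtain ⟨l, _, rfl⟩ := Finset.mem_image.1 hv'
      exact (hyJ' _).2 (Finset.mem_inter.1 hv).1
  set s := S.orderEmbOfFin rfl with hs
  have hs_range : ∀ l ∈ S, ∃ i, s i = l := fun l hl => by
    have := Finset.range_orderEmbOfFin S rfl
    rw [← Finset.mem_coe, ← this] at hl
    exact hl
  have hα : ∀ a, A.orderEmbOfFin hAcard a ∈ A := fun a => Finset.orderEmbOfFin_mem _ _ _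
  have hα_range : ∀ v ∈ A, ∃ a, A.orderEmbOfFin hAcard a = v := fun v hv => by
    rw [← Finset.mem_coe, ← Finset.range_orderEmbOfFin A hAcard] at hv
    exact hv
  have hmemA : ∀ v, v ∈ A ↔ v = x0 ∨ v = x1 ∨ v = y0 ∨ v = y1 := fun v => by simp [hA]
  have hγ : ∀ i, Γ.orderEmbOfFin hΓcard i ∈ Γ := fun a => Finset.orderEmbOfFin_mem _ _ _
  have hA_cases : ∀ v ∈ A, ∃ c : Fin 2, v = x (Fin.natAdd m c) ∨ v = y (Fin.natAdd m c) := by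
    intro v hv
    rcases (hmemA v).1 hv with h | h | h | h
    · exact ⟨0, Or.inl h⟩
    · exact ⟨1, Or.inl h⟩
    · exact ⟨0, Or.inr h⟩
    · exact ⟨1, Or.inr h⟩
  have hlo_lt : ∀ l, ∀ v ∈ A, lo l < v := by
    intro l v hv
    obtain ⟨c, rfl | rfl⟩ := hA_cases v hv
    · exact (min_le_left _ _).trans_lt (hx (hlast l c))
    · exact (min_le_right _ _).trans_lt (hy (hlast l c))
  have hhi_lt : ∀ l, hi l < A.orderEmbOfFin hAcard 2 := by
    intro l
    -- `hi l` lies below the last two terms of the sequence it comes from. Two of the four elements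
    -- of `A` exceed it, hence so does the third smallest.
    have h1 : ∃ v ∈ A, ∃ w ∈ A, v ≠ w ∧ hi l < v ∧ hi l < w := by
      rcases hhi_mem l with h | h
      · refine ⟨x0, by simp [hA], x1, by simp [hA], hx01.ne, ?_, ?_⟩ <;> rw [h] <;>
          exact hx (hlast l _)
      · refine ⟨y0, by simp [hA], y1, by simp [hA], hy01.ne, ?_, ?_⟩ <;> rw [h] <;>
          exact hy (hlast l _)
    obtain ⟨v, hv, w, hw, hvw, h1, h2⟩ := h1
    obtain ⟨a, rfl⟩ := hα_range v hv
    obtain ⟨b, rfl⟩ := hα_range w hw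
    by_contra hcon
    rw [not_lt] at hcon
    have ha := (Finset.orderEmbOfFin A hAcard).lt_iff_lt.1 (hcon.trans_lt h1)
    have hb := (Finset.orderEmbOfFin A hAcard).lt_iff_lt.1 (hcon.trans_lt h2)
    apply hvw
    congr 1
    omega
  have hnotA : ∀ l : Fin m, x (Fin.castAdd 2 l) ∉ A ∧ y (Fin.castAdd 2 l) ∉ A := by
    intro l
    constructor
    · intro h
      obtain ⟨c, h | h⟩ := hA_cases _ h
      · exact (hlast l c).ne (hx.injective h)
      · exact hxy _ _ h
    · intro h
      obtain ⟨c, h | h⟩ := hA_cases _ h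
      · exact hxy _ _ h.symm
      · exact (hlast l c).ne (hy.injective h)
  have hxΓ : ∀ i, x i ∉ Γ := by
    intro i h
    rcases (hmemΓ _).1 h with h | ⟨l, _, h⟩
    · exact (hxI' i).2 (Finset.mem_inter.1 h).2
    · exact hxy _ _ h
  have hyΓ : ∀ i, y i ∈ Γ → ∃ l ∉ S, i = Fin.castAdd 2 l := by
    intro i h
    rcases (hmemΓ _).1 h with h | ⟨l, hl, h⟩
    · exact absurd (Finset.mem_inter.1 h).1 (hyJ' i).2
    · exact ⟨l, hl, hy.injective h⟩
  let β : Fin 2 → Fin S.card → Fin n := ![fun i => lo (s i), fun i => hi (s i)]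
  have hβ : ∀ ν i, β ν i = x (Fin.castAdd 2 (s i)) ∨ β ν i = y (Fin.castAdd 2 (s i)) := by
    intro ν i
    fin_cases ν
    · exact hlo_mem _
    · exact hhi_mem _
  refine ⟨{
    m := S.card
    m_le := by omega
    α := A.orderEmbOfFin hAcard
    β := β
    γ := Γ.orderEmbOfFin hΓcard
    distinct := ?_
    α_lt := (A.orderEmbOfFin hAcard).strictMono
    β_pair_lt := fun i => hlohi _
    β_lt := ?_
    β_zero_lt := fun i => hlo_lt _ _ (hα _)
    β_one_lt := fun i => hhi_lt _
    γ_lt := (Γ.orderEmbOfFin hΓcard).strictMono }, ?_, ?_, ?_, ?_⟩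
  · refine Function.Injective.sumElim (A.orderEmbOfFin hAcard).injective
      (Function.Injective.sumElim ?_ (Γ.orderEmbOfFin hΓcard).injective ?_) ?_
    · rintro ⟨ν, i⟩ ⟨ν', i'⟩ h
      replace h : β ν i = β ν' i' := h
      have hi : s i = s i' := by
        rcases hβ ν i with h1 | h1 <;> rcases hβ ν' i' with h2 | h2 <;> rw [h1, h2] at h
        · exact Fin.castAdd_injective m 2 (hx.injective h)
        · exact absurd h (hxy _ _)
        · exact absurd h.symm (hxy _ _)
        · exact Fin.castAdd_injective m 2 (hy.injective h)
      obtain rfl := s.injective hi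
      fin_cases ν <;> fin_cases ν'
      · rfl
      · exact absurd h (hlohi _).ne
      · exact absurd h (hlohi _).ne'
      · rfl
    · rintro ⟨ν, i⟩ j h
      have h1 := hγ j
      rw [← h] at h1
      rcases hβ ν i with h2 | h2
      · exact hxΓ _ (h2 ▸ h1)
      · obtain ⟨l, hl, h3⟩ := hyΓ _ (h2 ▸ h1)
        exact hl (Fin.castAdd_injective m 2 h3 ▸ Finset.orderEmbOfFin_mem S rfl i)
    · rintro a (⟨ν, i⟩ | j) h
      · have h1 := hα a
        replace h : A.orderEmbOfFin hAcard a = β ν i := h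
        rw [h] at h1
        rcases hβ ν i with h2 | h2
        · exact (hnotA _).1 (h2 ▸ h1)
        · exact (hnotA _).2 (h2 ▸ h1)
      · have h1 := hα a
        have h2 := hγ j
        replace h : A.orderEmbOfFin hAcard a = Γ.orderEmbOfFin hΓcard j := h
        rw [← h] at h2
        obtain ⟨c, h3 | h3⟩ := hA_cases _ h1
        · exact hxΓ _ (h3 ▸ h2)
        · obtain ⟨l, _, h4⟩ := hyΓ _ (h3 ▸ h2)
          exact (hlast l c).ne h4.symm
  · intro ν
    fin_cases ν
    · exact hlo_mono.comp s.strictMono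
    · exact hhi_mono.comp s.strictMono
  · intro v
    rw [← hmemA]
    exact ⟨fun ⟨a, ha⟩ => ha ▸ hα a, hα_range v⟩
  · intro l hl
    obtain ⟨i, rfl⟩ := hs_range l hl
    exact ⟨i, rfl, rfl⟩
  · intro i
    exact ⟨s i, Finset.orderEmbOfFin_mem S rfl i, rfl, rfl⟩
  · intro v
    rw [← hmemΓ]
    refine ⟨fun ⟨a, ha⟩ => ha ▸ hγ a, fun hv => ?_⟩
    rw [← Finset.mem_coe, ← Finset.range_orderEmbOfFin Γ hΓcard] at hv
    exact hv

end Matching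

/-! ### From a minimal disagreement with `ω'` to a violated Plücker relation. -/

variable {k : Type*} [Field k] {n p : ℕ}

/-- If `ω` agrees with a decomposable `ω'` on all tuples with fewer than `m + 2` entries outside
those of `f₀`, but not on a tuple `f` with `m + 2` such entries, then some `G ω` violates the Plücker
relation. -/
theorem exists_pf_G_ne_zero (ω ω' : ⋀[k]^p (Fin n → k)) (hω' : IsDecomposable ω')
    (f₀ f : Fin p → Fin n) (hf₀ : Function.Injective f₀) (hf : Function.Injective f)
    (h₀ : pairing ω (fun i => LinearMap.proj (f₀ i)) ≠ 0)
    (h₁ : pairing (ω - ω') (fun i => LinearMap.proj (f i)) ≠ 0) (m : ℕ)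
    (hm : (Finset.univ.filter fun s => f s ∉ Finset.univ.image f₀).card = m + 2)
    (hmin : ∀ g : Fin p → Fin n,
      (Finset.univ.filter fun s => g s ∉ Finset.univ.image f₀).card < m + 2 →
        pairing (ω - ω') (fun i => LinearMap.proj (g i)) = 0) :
    ∃ T : IndexTriple p n, pf (T.G k ω) ≠ 0 := by
  set I := Finset.univ.image f₀ with hI
  set J := Finset.univ.image f with hJ
  have hIcard : I.card = p := by simp [hI, Finset.card_image_of_injective _ hf₀]
  have hJcard : J.card = p := by simp [hJ, Finset.card_image_of_injective _ hf]
  have hJI : (J \ I).card = m + 2 := by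
    rw [← hm, ← Finset.card_image_of_injective _ hf]
    congr 1
    ext v
    simp only [hJ, Finset.mem_sdiff, Finset.mem_image, Finset.mem_univ, true_and,
      Finset.mem_filter]
    constructor
    · rintro ⟨⟨i, rfl⟩, h⟩
      exact ⟨i, h, rfl⟩
    · rintro ⟨i, h, rfl⟩
      exact ⟨⟨i, rfl⟩, h⟩
  have hIJ : (I \ J).card = m + 2 := by
    rw [← hJI]
    exact Finset.card_sdiff_comm (hIcard.trans hJcard.symm)
  set x := (I \ J).orderEmbOfFin hIJ with hx
  set y := (J \ I).orderEmbOfFin hJI with hy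
  have hxr : ∀ v, v ∈ Set.range x ↔ v ∈ I \ J := fun v => by
    rw [hx, Finset.range_orderEmbOfFin, Finset.mem_coe]
  have hyr : ∀ v, v ∈ Set.range y ↔ v ∈ J \ I := fun v => by
    rw [hy, Finset.range_orderEmbOfFin, Finset.mem_coe]
  have hxI : ∀ i, x i ∈ I ∧ x i ∉ J := fun i => Finset.mem_sdiff.1 ((hxr _).1 ⟨i, rfl⟩)
  have hyJ : ∀ i, y i ∈ J ∧ y i ∉ I := fun i => Finset.mem_sdiff.1 ((hyr _).1 ⟨i, rfl⟩)
  have hxy : ∀ i j, x i ≠ y j := fun i j h => (hxI i).2 (h ▸ (hyJ j).1)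
  have hlast : ∀ (l : Fin m) (c : Fin 2), Fin.castAdd 2 l ≠ Fin.natAdd m c := fun l c h => by
    have := congrArg Fin.val h
    simp only [Fin.val_castAdd, Fin.val_natAdd] at this
    omega
  have hfin : ∀ i : Fin (m + 2), (∃ l, i = Fin.castAdd 2 l) ∨ i = Fin.natAdd m 0 ∨
      i = Fin.natAdd m 1 := fun i => by
    refine Fin.addCases (fun l => Or.inl ⟨l, rfl⟩) (fun c => Or.inr ?_) i
    fin_cases c <;> simp
  have h01 : (Fin.natAdd m (0 : Fin 2)) ≠ Fin.natAdd m 1 := by simp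
  have hpos : ∀ l : Fin m, ∃ s, f₀ s = x (Fin.castAdd 2 l) := fun l => by
    simpa [hI] using (hxI (Fin.castAdd 2 l)).1
  choose pos hpos using hpos
  set e : Fin n → Module.Dual k (Fin n → k) := fun v => LinearMap.proj v with he
  -- choice of the pairs which are kept
  have hsel : ∃ S : Finset (Fin m), ∀ u : Fin p → Module.Dual k (Fin n → k),
      (∀ l, u (pos l) = if l ∈ S then e (y (Fin.castAdd 2 l)) + e (x (Fin.castAdd 2 l))
        else e (y (Fin.castAdd 2 l))) →
      (∀ s, (∀ l, pos l ≠ s) → u s = e (f₀ s)) → pairing ω u ≠ 0 := by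
    have hposinj : Function.Injective pos := fun l l' h => by
      have h1 := hpos l
      rw [h, hpos l'] at h1
      exact (Fin.castAdd_injective m 2 (x.injective h1)).symm
    -- Start from the nonzero coordinate at `f₀` and treat only the slots holding some `x_l` with
    -- `l` among the first `m`. The default `0` in the other slots is never read.
    obtain ⟨S, hS⟩ := exists_subset_multilinear_ne_zero (pairing ω).toMultilinearMap
      (fun s => if h : ∃ l, pos l = s then e (y (Fin.castAdd 2 h.choose)) else 0)
      (fun s => e (f₀ s)) h₀ (Finset.univ.image pos)
    refine ⟨Finset.univ.filter fun l => pos l ∈ S, fun u hu hu' => ?_⟩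
    refine fun h0 => hS (Eq.trans ?_ h0)
    change pairing ω _ = _
    congr 1
    ext s : 1
    symm
    by_cases hs : ∃ l, pos l = s
    · obtain ⟨l, rfl⟩ := hs
      have h : ∃ l', pos l' = pos l := ⟨l, rfl⟩
      have h2 : h.choose = l := hposinj h.choose_spec
      have hin : pos l ∈ Finset.univ.image pos := by simp
      rw [hu, if_pos hin, dif_pos h, h2, hpos]
      simp
    · rw [hu' s (fun l hl => hs ⟨l, hl⟩), if_neg]
      simpa using hs
  obtain ⟨S, hS⟩ := hsel
  obtain ⟨T, hTα, hTβ, hTβ', hTγ⟩ := exists_indexTriple I J hJcard x y x.strictMono y.strictMono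
    hxr hyr S
  refine ⟨T, fun hpf => ?_⟩
  obtain ⟨v', rfl⟩ := hω'
  have hpf' := T.pf_G_ιMulti k v'
  set ω' := exteriorPower.ιMulti k p v'
  -- the shape of the linear forms `T.form k v`
  have hform : ∀ v ∈ T.S', ∃ g : Fin n, ∃ w : Module.Dual k (Fin n → k),
      T.form k v = e g + w ∧ (w = 0 ∨ ∃ h ∈ I, g ∉ I ∧ w = e h) ∧
      ((g = v ∧ ((∃ a, T.α a = v) ∨ v ∈ I ∩ J)) ∨ ∃ l : Fin m, g = y (Fin.castAdd 2 l) ∧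
        ((l ∈ S ∧ v = max (x (Fin.castAdd 2 l)) (y (Fin.castAdd 2 l))) ∨
          (l ∉ S ∧ v = y (Fin.castAdd 2 l)))) := by
    intro v hv
    by_cases hβ : ∃ i, T.β 1 i = v
    · obtain ⟨i, rfl⟩ := hβ
      obtain ⟨l, hl, h0, h1⟩ := hTβ' i
      refine ⟨y (Fin.castAdd 2 l), e (x (Fin.castAdd 2 l)), ?_,
        Or.inr ⟨_, (hxI _).1, (hyJ _).2, rfl⟩, Or.inr ⟨l, rfl, Or.inl ⟨hl, h1⟩⟩⟩
      rw [T.form_β, h0, h1]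
      rcases le_total (x (Fin.castAdd 2 l)) (y (Fin.castAdd 2 l)) with h | h
      · rw [max_eq_right h, min_eq_left h]
      · rw [max_eq_left h, min_eq_right h, add_comm]
    · have h1 : T.form k v = e v + 0 := by
        rw [add_zero, T.form_of_forall_ne k fun i hi => hβ ⟨i, hi⟩]
      rcases T.mem_S'_iff.1 hv with ha | hb | hc
      · exact ⟨v, 0, h1, Or.inl rfl, Or.inl ⟨rfl, Or.inl ha⟩⟩
      · exact absurd hb hβ
      · rcases (hTγ v).1 hc with h | ⟨l, hl, h⟩
        · exact ⟨v, 0, h1, Or.inl rfl, Or.inl ⟨rfl, Or.inr h⟩⟩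
        · exact ⟨v, 0, h1, Or.inl rfl, Or.inr ⟨l, h, Or.inr ⟨hl, h⟩⟩⟩
  -- reduction of the coordinates of `G (ω - ω')` to those of `ω - ω'`
  have hcoord : ∀ a b : Fin 4, a < b → ∃ g : Fin p → Fin n,
      coord₂ (T.G k ω) a b - coord₂ (T.G k ω') a b = pairing (ω - ω') (fun s => e (g s)) ∧
      Function.Injective g ∧
      ∀ s, g s ∈ I ∪ J ∧ (∀ c, g s = T.α c → c ≠ a ∧ c ≠ b) ∧
        ((∃ c, g s = T.α c) ∨ g s ∈ J) := by
    intro a b hab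
    obtain ⟨κ, hκ, hκr, hκc⟩ := T.exists_coord₂_G_eq k hab
    have hκS : ∀ s, κ s ∈ T.S' := fun s => ((hκr _).1 ⟨s, rfl⟩).1
    choose g w hgw hw hg using fun s => hform (κ s) (hκS s)
    have hyα : ∀ (l : Fin m) (c : Fin 4), y (Fin.castAdd 2 l) ≠ T.α c := by
      intro l c h
      rcases (hTα _).1 ⟨c, h.symm⟩ with h | h | h | h
      · exact hxy _ _ h.symm
      · exact hxy _ _ h.symm
      · exact hlast _ _ (y.injective h)
      · exact hlast _ _ (y.injective h)
    have hginj : Function.Injective g := by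
      intro s t hst
      apply hκ
      have haux : ∀ s (l : Fin m), g s = κ s →
          ((∃ a, T.α a = κ s) ∨ κ s ∈ I ∩ J) → g s ≠ y (Fin.castAdd 2 l) := by
        intro s l h1 h2 h3
        rcases h2 with ⟨c, h2⟩ | h2
        · exact hyα l c (by rw [h2, ← h1, h3])
        · rw [← h1, h3] at h2
          exact (hyJ _).2 (Finset.mem_inter.1 h2).1
      rcases hg s with ⟨h1, h1'⟩ | ⟨l, h1, h1'⟩ <;> rcases hg t with ⟨h2, h2'⟩ | ⟨l', h2, h2'⟩
      · rw [← h1, ← h2, hst]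
      · exact absurd (hst.trans h2) (haux s l' h1 h1')
      · exact absurd (hst.symm.trans h1) (haux t l h2 h2')
      · have : l = l' := Fin.castAdd_injective m 2 (y.injective (by rw [← h1, ← h2, hst]))
        subst this
        rcases h1' with ⟨h3, h4⟩ | ⟨h3, h4⟩ <;> rcases h2' with ⟨h5, h6⟩ | ⟨h5, h6⟩
        · rw [h4, h6]
        · exact absurd h3 h5
        · exact absurd h5 h3
        · rw [h4, h6]
    have hgα : ∀ s, g s ∈ I ∪ J ∧ (∀ c, g s = T.α c → c ≠ a ∧ c ≠ b) ∧
        ((∃ c, g s = T.α c) ∨ g s ∈ J) := by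
      intro s
      rcases hg s with ⟨h1, h2⟩ | ⟨l, h1, h2⟩
      · refine ⟨?_, fun c hc => ?_, ?_⟩
        · rw [h1]
          rcases h2 with h2 | h2
          · rcases (hTα _).1 h2 with h | h | h | h <;> rw [h]
            · exact Finset.mem_union_left _ (hxI _).1
            · exact Finset.mem_union_left _ (hxI _).1
            · exact Finset.mem_union_right _ (hyJ _).1
            · exact Finset.mem_union_right _ (hyJ _).1
          · exact Finset.mem_union_left _ (Finset.mem_inter.1 h2).1
        · have := ((hκr (κ s)).1 ⟨s, rfl⟩).2
          rw [← h1, hc, T.α_lt.injective.ne_iff, T.α_lt.injective.ne_iff] at this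
          exact this
        · rw [h1]
          rcases h2 with ⟨c, h2⟩ | h2
          · exact Or.inl ⟨c, h2.symm⟩
          · exact Or.inr (Finset.mem_inter.1 h2).2
      · refine ⟨?_, fun c hc => ?_, ?_⟩
        · rw [h1]
          exact Finset.mem_union_right _ (hyJ _).1
        · exact absurd (h1.symm.trans hc) (hyα l c)
        · rw [h1]
          exact Or.inr (hyJ _).1
    refine ⟨g, ?_, hginj, hgα⟩
    rw [hκc, hκc, ← pairing_sub]
    simp only [hgw]
    -- The bound on the count holds because `g` is injective and its values outside `I` lie in `J \
    -- I`.
    apply alternating_add_eq (pairing (ω - ω')) e I (m + 2) hmin g w hw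
    rw [← hJI, ← Finset.card_image_of_injective _ hginj]
    apply Finset.card_le_card
    intro v hv
    obtain ⟨s, hs, rfl⟩ := Finset.mem_image.1 hv
    have hs' := (Finset.mem_filter.1 hs).2
    exact Finset.mem_sdiff.2 ⟨(Finset.mem_union.1 (hgα s).1).resolve_left hs', hs'⟩
  -- the four indices in `α`
  have hαx : ∀ c : Fin 2, ∃ a, T.α a = x (Fin.natAdd m c) := fun c => by
    rw [hTα]
    fin_cases c <;> simp
  have hαy : ∀ c : Fin 2, ∃ a, T.α a = y (Fin.natAdd m c) := fun c => by
    rw [hTα]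
    fin_cases c <;> simp
  choose ax hax using hαx
  choose ay hay using hαy
  have hxyne : ∀ c d, ax c ≠ ay d := fun c d h => hxy (Fin.natAdd m c) (Fin.natAdd m d) (by
    rw [← hax, ← hay, h])
  have hax01 : ax 0 ≠ ax 1 := fun h => h01 (x.injective (by rw [← hax, ← hax, h]))
  have hay01 : ay 0 ≠ ay 1 := fun h => h01 (y.injective (by rw [← hay, ← hay, h]))
  -- How the two `x` and two `y` interleave in `𝒜` is unknown; only the increasing pairs of
  -- positions, `a < b` for `y` and `c < d` for `x`, are needed.
  have hsort : ∀ b : Fin 2 → Fin 4, b 0 ≠ b 1 → ∃ c d, c < d ∧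
      (∀ i, b i = c ∨ b i = d) ∧ (∃ i, b i = c) ∧ ∃ i, b i = d := by
    intro b hb
    rcases lt_or_gt_of_ne hb with h | h
    · exact ⟨b 0, b 1, h, fun i => by fin_cases i <;> simp, ⟨0, rfl⟩, ⟨1, rfl⟩⟩
    · exact ⟨b 1, b 0, h, fun i => by fin_cases i <;> simp, ⟨1, rfl⟩, ⟨0, rfl⟩⟩
  obtain ⟨a, b, hab, hayab, ⟨ia, hia⟩, ⟨ib, hib⟩⟩ := hsort ay hay01
  obtain ⟨c, d, hcd, haxcd, ⟨ic, hic⟩, ⟨jd, hid⟩⟩ := hsort ax hax01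
  have hagree : ∀ i j, i < j → (i, j) ≠ (c, d) →
      coord₂ (T.G k ω) i j = coord₂ (T.G k ω') i j := by
    intro i j hij hne
    obtain ⟨g, hg, hginj, hgs⟩ := hcoord i j hij
    rw [← sub_eq_zero, hg]
    apply hmin
    -- A pair other than `c, d` omits one of the last two `y`, which leaves fewer than `m + 2`
    -- indices outside `I`.
    have hay_mem : ∃ r : Fin 2, ay r = i ∨ ay r = j := by
      by_contra hcon
      push Not at hcon
      have h1 := (hcon ia).1
      have h2 := (hcon ia).2
      have h3 := (hcon ib).1
      have h4 := (hcon ib).2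
      rw [hia] at h1 h2
      rw [hib] at h3 h4
      have hac : a ≠ c := hic ▸ hia ▸ (hxyne _ _).symm
      have had : a ≠ d := hid ▸ hia ▸ (hxyne _ _).symm
      have hbc : b ≠ c := hic ▸ hib ▸ (hxyne _ _).symm
      have hbd : b ≠ d := hid ▸ hib ▸ (hxyne _ _).symm
      apply hne
      rw [Prod.mk.injEq]
      omega
    obtain ⟨r, hr⟩ := hay_mem
    rw [← hJI, ← Finset.card_image_of_injective _ hginj]
    apply Finset.card_lt_card
    rw [Finset.ssubset_iff_of_subset]
    · refine ⟨y (Fin.natAdd m r), (hyr _).1 ⟨_, rfl⟩, fun h => ?_⟩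
      obtain ⟨s, -, hs⟩ := Finset.mem_image.1 h
      have h3 := (hgs s).2.1 (ay r) (by rw [hs, hay])
      exact hr.elim h3.1 h3.2
    · intro v hv
      obtain ⟨s, hs, rfl⟩ := Finset.mem_image.1 hv
      have hs' := (Finset.mem_filter.1 hs).2
      exact Finset.mem_sdiff.2 ⟨(Finset.mem_union.1 (hgs s).1).resolve_left hs', hs'⟩
  rcases pf_eq_zero_imp hpf hpf' hab hcd (hic ▸ hia ▸ (hxyne _ _).symm)
    (hid ▸ hia ▸ (hxyne _ _).symm) (hic ▸ hib ▸ (hxyne _ _).symm)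
    (hid ▸ hib ▸ (hxyne _ _).symm) hagree with h | h
  · -- the coordinate which is nonzero by the choice of `S`
    obtain ⟨κ, hκ, hκr, hκc⟩ := T.exists_coord₂_G_eq k hab
    rw [hκc] at h
    have hu : ∀ s, ∃ v ∈ T.S', v ≠ T.α a ∧ v ≠ T.α b ∧
        ((∃ l, pos l = s ∧ (v = x (Fin.castAdd 2 l) ∨ v = y (Fin.castAdd 2 l)) ∧
          T.form k v = if l ∈ S then e (y (Fin.castAdd 2 l)) + e (x (Fin.castAdd 2 l))
            else e (y (Fin.castAdd 2 l))) ∨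
          ((∀ l, pos l ≠ s) ∧ v = f₀ s ∧ T.form k v = e (f₀ s))) := by
      have hyab : ∀ v, (∀ c, v ≠ y (Fin.natAdd m c)) → v ≠ T.α a ∧ v ≠ T.α b := by
        intro v hv
        rw [← hia, ← hib, hay, hay]
        exact ⟨hv _, hv _⟩
      intro s
      by_cases hs : ∃ l, pos l = s
      · obtain ⟨l, rfl⟩ := hs
        have hmax : ∀ v, v = x (Fin.castAdd 2 l) ∨ v = y (Fin.castAdd 2 l) →
            ∀ c, v ≠ y (Fin.natAdd m c) := by
          rintro v (rfl | rfl) c h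
          · exact hxy _ _ h
          · exact hlast _ _ (y.injective h)
        by_cases hl : l ∈ S
        · obtain ⟨i, h0, h1⟩ := hTβ l hl
          have h2 := max_choice (x (Fin.castAdd 2 l)) (y (Fin.castAdd 2 l))
          rw [← h1] at h2
          obtain ⟨h3, h4⟩ := hyab _ (hmax _ h2)
          refine ⟨T.β 1 i, T.mem_S'_iff.2 (Or.inr (Or.inl ⟨i, rfl⟩)), h3, h4,
            Or.inl ⟨l, rfl, h2, ?_⟩⟩
          rw [if_pos hl, T.form_β, h0, h1]
          rcases le_total (x (Fin.castAdd 2 l)) (y (Fin.castAdd 2 l)) with h | h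
          · rw [max_eq_right h, min_eq_left h]
          · rw [max_eq_left h, min_eq_right h, add_comm]
        · obtain ⟨h3, h4⟩ := hyab _ (hmax _ (Or.inr rfl))
          have h5 := (hTγ (y (Fin.castAdd 2 l))).2 (Or.inr ⟨l, hl, rfl⟩)
          refine ⟨y (Fin.castAdd 2 l), T.mem_S'_iff.2 (Or.inr (Or.inr h5)), h3, h4,
            Or.inl ⟨l, rfl, Or.inr rfl, ?_⟩⟩
          rw [if_neg hl, T.form_of_forall_ne]
          intro i hi
          obtain ⟨j, hj⟩ := h5
          simpa using @T.distinct (Sum.inr (Sum.inl (1, i))) (Sum.inr (Sum.inr j))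
            (hi.trans hj.symm)
      · push Not at hs
        have hfI : f₀ s ∈ I := by simp [hI]
        have hmem : (∃ c, T.α c = f₀ s) ∨ ∃ i, T.γ i = f₀ s := by
          by_cases hsJ : f₀ s ∈ J
          · exact Or.inr ((hTγ _).2 (Or.inl (Finset.mem_inter.2 ⟨hfI, hsJ⟩)))
          · obtain ⟨i, hi⟩ := (hxr _).2 (Finset.mem_sdiff.2 ⟨hfI, hsJ⟩)
            rcases hfin i with ⟨l, rfl⟩ | rfl | rfl
            · exact absurd (hf₀ ((hpos l).trans hi)) (hs l)
            · exact Or.inl ⟨ax 0, (hax 0).trans hi⟩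
            · exact Or.inl ⟨ax 1, (hax 1).trans hi⟩
        obtain ⟨h3, h4⟩ := hyab (f₀ s) (fun c h => (hyJ _).2 (h ▸ hfI))
        refine ⟨f₀ s, T.mem_S'_iff.2 (hmem.imp id Or.inr), h3, h4, Or.inr ⟨hs, rfl, ?_⟩⟩
        rw [T.form_of_forall_ne]
        intro i hi
        rcases hmem with ⟨j, hj⟩ | ⟨j, hj⟩
        · exact T.β_one_ne_α i j (hi.trans hj.symm)
        · simpa using @T.distinct (Sum.inr (Sum.inl (1, i))) (Sum.inr (Sum.inr j))
            (hi.trans hj.symm)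
    choose κ₀ hκ₀S hκ₀a hκ₀b hκ₀ using hu
    have hκ₀inj : Function.Injective κ₀ := by
      have haux : ∀ t (l : Fin m), (∀ l, pos l ≠ t) →
          f₀ t ≠ x (Fin.castAdd 2 l) ∧ f₀ t ≠ y (Fin.castAdd 2 l) := fun t l ht =>
        ⟨fun h => ht l (hf₀ ((hpos l).trans h.symm)), fun h => (hyJ (Fin.castAdd 2 l)).2
          (h ▸ by simp [hI])⟩
      intro s t hst
      rcases hκ₀ s with ⟨l, rfl, h1, -⟩ | ⟨h1, h2, -⟩ <;>
        rcases hκ₀ t with ⟨l', rfl, h1', -⟩ | ⟨h1', h2', -⟩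
      · rw [hst] at h1
        have : l = l' := by
          rcases h1 with h | h <;> rcases h1' with h' | h' <;> rw [h] at h'
          · exact Fin.castAdd_injective m 2 (x.injective h')
          · exact absurd h' (hxy _ _)
          · exact absurd h'.symm (hxy _ _)
          · exact Fin.castAdd_injective m 2 (y.injective h')
        rw [this]
      · rw [hst, h2'] at h1
        exact absurd h1 (not_or.2 (haux t l h1'))
      · rw [← hst, h2] at h1'
        exact absurd h1' (not_or.2 (haux s l' h1))
      · exact hf₀ (by rw [← h2, ← h2', hst])
    have h2 := (alternating_eq_zero_iff_of_range_subset (pairing ω) (T.form k) hκ₀inj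
      (fun s => (hκr _).2 ⟨hκ₀S s, hκ₀a s, hκ₀b s⟩)).2 h
    refine hS _ (fun l => ?_) (fun s hs => ?_) h2
    · rcases hκ₀ (pos l) with ⟨l', hl', -, h3⟩ | ⟨h3, -⟩
      · have h4 := hpos l
        rw [← hl', hpos l'] at h4
        rw [h3, Fin.castAdd_injective m 2 (x.injective h4)]
      · exact absurd rfl (h3 l)
    · rcases hκ₀ s with ⟨l', hl', -⟩ | ⟨-, -, h3⟩
      · exact absurd hl' (hs l')
      · exact h3
  · -- the coordinate where `G ω` and `G ω'` differ
    obtain ⟨g, hg, hginj, hgs⟩ := hcoord c d hcd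
    rw [h, sub_self] at hg
    refine h₁ ((alternating_eq_zero_iff_of_range_subset (pairing (ω - ω')) e hginj
      (fun s => ?_)).1 hg.symm)
    have h2 : g s ∈ J := by
      rcases (hgs s).2.2 with ⟨j, hj⟩ | h
      · have h3 := (hgs s).2.1 j hj
        have h4 : ∀ i, j ≠ ax i := fun i hi => by
          rcases haxcd i with h | h
          · exact h3.1 (hi.trans h)
          · exact h3.2 (hi.trans h)
        rcases (hTα _).1 ⟨j, rfl⟩ with h | h | h | h
        · exact absurd (T.α_lt.injective (h.trans (hax 0).symm)) (h4 0)
        · exact absurd (T.α_lt.injective (h.trans (hax 1).symm)) (h4 1)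
        · rw [hj, h]; exact (hyJ _).1
        · rw [hj, h]; exact (hyJ _).1
      · exact h
    simpa [hJ] using h2

theorem injective_of_pairing_ne_zero {ω : ⋀[k]^p (Fin n → k)} {f : Fin p → Fin n}
    (h : pairing ω (fun i => LinearMap.proj (f i)) ≠ 0) : Function.Injective f := by
  intro i j hij
  by_contra hne
  exact h (AlternatingMap.map_eq_zero_of_eq _ _ (i := i) (j := j) (by simp only [hij]) hne)

/-- An element whose coordinates vanish on all tuples obtained from `f₀` by changing one entry has
vanishing coordinates on all tuples with at most one entry outside those of `f₀`. -/
theorem pairing_eq_zero_of_card_le_one {Δ : ⋀[k]^p (Fin n → k)} (hp : 1 ≤ p) {f₀ f : Fin p → Fin n}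
    (hf : Function.Injective f) (hf₀ : Function.Injective f₀)
    (h : ∀ r y, pairing Δ (fun i => LinearMap.proj (Function.update f₀ r y i)) = 0)
    (hcard : (Finset.univ.filter fun s => f s ∉ Finset.univ.image f₀).card ≤ 1) :
    pairing Δ (fun i => LinearMap.proj (f i)) = 0 := by
  rcases Nat.le_one_iff_eq_zero_or_eq_one.1 hcard with h0 | h1
  · rw [Finset.card_eq_zero, Finset.filter_eq_empty_iff] at h0
    rw [alternating_eq_zero_iff_of_range_subset _ (fun v => LinearMap.proj v) hf (g := f₀)]
    · simpa using h ⟨0, hp⟩ (f₀ ⟨0, hp⟩)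
    · intro i
      simpa using h0 (Finset.mem_univ i)
  · obtain ⟨s, hs⟩ := Finset.card_eq_one.1 h1
    have hs1 : ∀ i, f i ∉ Finset.univ.image f₀ ↔ i = s := fun i => by
      rw [← Finset.mem_singleton, ← hs, Finset.mem_filter]
      simp
    -- If `f` hit every `f₀ r`, counting would put all its values, including `f s`, in the image of
    -- `f₀`.
    have hex : ∃ r, ∀ i, f i ≠ f₀ r := by
      by_contra hcon
      push Not at hcon
      choose τ hτ using hcon
      have hτinj : Function.Injective τ := fun i j hij => hf₀ (by rw [← hτ, ← hτ, hij])
      obtain ⟨r, hr⟩ := Finite.injective_iff_surjective.1 hτinj s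
      exact (hs1 s).2 rfl (by rw [← hr, hτ]; simp)
    obtain ⟨r, hr⟩ := hex
    rw [alternating_eq_zero_iff_of_range_subset _ (fun v => LinearMap.proj v) hf
      (g := Function.update f₀ r (f s))]
    · exact h r (f s)
    · intro i
      by_cases hi : i = s
      · exact ⟨r, by simp [hi]⟩
      · have h2 : f i ∈ Finset.univ.image f₀ := by
          by_contra h3
          exact hi ((hs1 i).1 h3)
        obtain ⟨t, -, ht⟩ := Finset.mem_image.1 h2
        refine ⟨t, ?_⟩
        rw [Function.update_of_ne, ht]
        rintro rfl
        exact hr i ht.symm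

theorem exists_not_isDecomposable_G (hp : 1 ≤ p) (ω : ⋀[k]^p (Fin n → k))
    (hω : ¬ IsDecomposable ω) : ∃ T : IndexTriple p n, ¬ IsDecomposable (T.G k ω) := by
  classical
  obtain ⟨f₀, h₀⟩ : ∃ f₀ : Fin p → Fin n, pairing ω (fun i => LinearMap.proj (f₀ i)) ≠ 0 := by
    by_contra hcon
    push Not at hcon
    -- If all coordinates vanish, `ω` is zero, which is a wedge of zero vectors because `p ≥ 1`.
    refine hω ⟨fun _ => 0, eq_of_pairing_eq fun f _ => ?_⟩
    rw [hcon, pairing_ιMulti]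
    exact (Matrix.det_eq_zero_of_row_eq_zero ⟨0, hp⟩ (by simp)).symm
  have hf₀ := injective_of_pairing_ne_zero h₀
  obtain ⟨ω', hω', heq⟩ := exists_isDecomposable_pairing_eq hp ω f₀ h₀
  have hex : ∃ q, ∃ f : Fin p → Fin n, pairing (ω - ω') (fun i => LinearMap.proj (f i)) ≠ 0 ∧
      (Finset.univ.filter fun s => f s ∉ Finset.univ.image f₀).card = q := by
    by_contra hcon
    push Not at hcon
    have : ω = ω' := by
      apply eq_of_pairing_eq
      intro f _
      by_contra hne
      refine hcon _ f ?_ rfl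
      rwa [pairing_sub, sub_ne_zero]
    exact hω (this ▸ hω')
  obtain ⟨f, h₁, hq⟩ := Nat.find_spec hex
  have hf := injective_of_pairing_ne_zero h₁
  have hmin : ∀ g : Fin p → Fin n,
      (Finset.univ.filter fun s => g s ∉ Finset.univ.image f₀).card < Nat.find hex →
        pairing (ω - ω') (fun i => LinearMap.proj (g i)) = 0 := by
    intro g hg
    by_contra hne
    exact Nat.find_min hex hg ⟨g, hne, rfl⟩
  -- The approximation `ω'` has no disagreement at distance `0` or `1`, so there are two indices on
  -- each side to put in `𝒜`.
  have h2 : 2 ≤ Nat.find hex := by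
    by_contra hcon
    refine h₁ (pairing_eq_zero_of_card_le_one hp hf hf₀ (fun r y => ?_) (by omega))
    rw [pairing_sub, heq, sub_self]
  obtain ⟨m, hm⟩ := Nat.exists_eq_add_of_le' h2
  rw [hm] at hq hmin
  obtain ⟨T, hT⟩ := exists_pf_G_ne_zero ω ω' hω' f₀ f hf₀ hf h₀ h₁ m hq hmin
  exact ⟨T, fun h => hT ((isDecomposable_iff_pf _).1 h)⟩

end GrassmannCone

theorem mainTheorem2 (k : Type*) [Field k] (p n : ℕ) (hp : 1 ≤ p) :
    (∀ T : GrassmannCone.IndexTriple p n, GrassmannCone.IsGCP (T.G k)) ∧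
    ∀ ω : ⋀[k]^p (Fin n → k),
      ¬ GrassmannCone.IsDecomposable ω ↔
        ∃ T : GrassmannCone.IndexTriple p n, ¬ GrassmannCone.IsDecomposable (T.G k ω) := by
  refine ⟨fun T => T.isGCP_G k, fun ω => ⟨GrassmannCone.exists_not_isDecomposable_G hp ω, ?_⟩⟩
  rintro ⟨T, hT⟩ hω
  exact hT (T.isGCP_G k ⟨ω, hω, rfl⟩)
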